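/- Let $r,s\ge 1$ and $t\ge 0$ be integers, and put $\phi_x=2\pi x/(2r+1)$ for $x\in\{1,\dots,2r+1\}$ and $u_{\phi}=\begin{pmatrix}1&0\\0&e^{i\phi}\end{pmatrix}$. Consider the following game $\mathcal L$ between Bobby and Evelyn, where Evelyn has a private quantum memory of arbitrary finite dimension (not bounded in advance, and possibly changing from round to round) in an initial state of her choice. 1. Bobby chooses $x\in\{1,\dots,2r+1\}$ uniformly at random, keeps it secret, and sends Evelyn a qubit in the state $|0\rangle$. 2. For $i=1,\dots,t$: Evelyn applies a quantum operation (a completely positive trace-preserving map) $\Phi_i$ to the qubit she holds together with her memory, and sends one qubit to Bobby, who applies $u_{\phi_x}$ to it and returns it. 3. Bobby chooses $b\in\{0,1\}$ uniformly at random, independently of $x$, and sends Evelyn a qubit in the state $\frac1{\sqrt2}\big(|0\rangle+(-1)^b e^{i\phi_x}|1\rangle\big)$. 4. Evelyn applies a quantum operation $\Phi_{t+1}$ to everything she holds and sends one qubit to Bobby. 5. Bobby measures this qubit in the computational basis; his test passes if the outcome equals $b$. Let $\mathcal L^{\|s}$ be the parallel $s$-fold repetition of $\mathcal L$: $s$ copies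 of Bobby, with independent choices $(x_1,b_1),\dots,(x_s,b_s)$, play simultaneously, so that every message consists of $s$ qubits, the $j$-th of which is handled by the $j$-th copy; Evelyn's quantum operations may act jointly on all $s$ qubits of each message and on her memory. Then the maximum $\alpha$, over all of Evelyn's strategies in $\mathcal L$, of the probability that Bobby's test passes is attained; the maximum $\alpha'$, over all of Evelyn's strategies in $\mathcal L^{\|s}$, of the probability that all $s$ tests pass is attained; and $$\alpha'=\alpha^s .$$ -/

import Mathlib

open scoped Matrix Kronecker ComplexOrder

namespace PhaseGame

/-! Quantum systems are finite-dimensional and are described in a fixed orthonormal basis labelled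
by a finite type: vectors are functions `A → ℂ`, operators are matrices `Matrix A A ℂ`, and the
tensor product of two systems is labelled by the product of their label types. -/

/-- The rank-one operator `|ψ⟩⟨ψ|`. -/
def pureState {A : Type} (ψ : A → ℂ) : Matrix A A ℂ :=
  Matrix.vecMulVec ψ (star ψ)

/-- The map `Φ ⊗ id` on operators of a system `A` together with an ancilla `R`. -/
def tensorId {A B : Type} (Φ : Matrix A A ℂ →ₗ[ℂ] Matrix B B ℂ) (R : Type)
    (ρ : Matrix (A × R) (A × R) ℂ) : Matrix (B × R) (B × R) ℂ :=
  Matrix.of fun p q => Φ (Matrix.of fun a a' => ρ (a, p.2) (a', q.2)) p.1 q.1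

/-- Admissible quantum operations from the system `A` to the system `B`: linear maps on operators
that are completely positive and trace preserving. -/
structure Channel (A B : Type) [Fintype A] [Fintype B] where
  map : Matrix A A ℂ →ₗ[ℂ] Matrix B B ℂ
  completelyPositive : ∀ (n : ℕ) (ρ : Matrix (A × Fin n) (A × Fin n) ℂ),
    ρ.PosSemidef → (tensorId map (Fin n) ρ).PosSemidef
  tracePreserving : ∀ ρ : Matrix A A ℂ, (map ρ).trace = ρ.trace

/-- Bobby's actions in a game of the kind considered here. `Q` labels the basis of the register
that carries a message, and `Ω` is the finite set of Bobby's secret choices, from which he draws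
uniformly at random. Bobby first sends `first`; he then applies `gate ω` to each of the messages
that he receives in the first `t` rounds and returns it; after these rounds he also sends
`challenge ω`; finally he measures the last message in the computational basis, and his test passes
if and only if the outcome is `answer ω`. -/
structure Bobby (Q Ω : Type) where
  first : Q → ℂ
  gate : Ω → Matrix Q Q ℂ
  challenge : Ω → Q → ℂ
  answer : Ω → Q

/-- Evelyn's actions. She has, between the rounds, a private memory of arbitrary finite dimension
(`mem i` before round `i`, counted from `0`), which starts in a state of her choice. In each of the
first `t` rounds she applies a quantum operation to the message that she holds together with her
memory, and sends the resulting message. Her last operation acts on the challenge, the message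
returned in the preceding round and her memory, and outputs the last message (whatever else she
holds is discarded). -/
structure Evelyn (Q : Type) [Fintype Q] (t : ℕ) where
  mem : Fin (t + 1) → ℕ
  init : Matrix (Fin (mem 0)) (Fin (mem 0)) ℂ
  init_posSemidef : init.PosSemidef
  init_trace : init.trace = 1
  op : (i : Fin t) → Channel (Q × Fin (mem i.castSucc)) (Q × Fin (mem i.succ))
  last : Channel (Q × (Q × Fin (mem (Fin.last t)))) Q

section Play

variable {Q Ω : Type} [Fintype Q] [DecidableEq Q] [Fintype Ω] {t : ℕ}

/-- The joint state of the message held by Evelyn and of her memory after the first `i` rounds, if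
Bobby's secret choice is `ω`. -/
def stateAfter (G : Bobby Q Ω) (E : Evelyn Q t) (ω : Ω) (i : Fin (t + 1)) :
    Matrix (Q × Fin (E.mem i)) (Q × Fin (E.mem i)) ℂ :=
  Fin.induction
    (motive := fun i : Fin (t + 1) => Matrix (Q × Fin (E.mem i)) (Q × Fin (E.mem i)) ℂ)
    (pureState G.first ⊗ₖ E.init)
    (fun i ρ =>
      (G.gate ω ⊗ₖ (1 : Matrix (Fin (E.mem i.succ)) (Fin (E.mem i.succ)) ℂ)) * (E.op i).map ρ *
        (G.gate ω ⊗ₖ (1 : Matrix (Fin (E.mem i.succ)) (Fin (E.mem i.succ)) ℂ))ᴴ)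
    i

/-- The state of the last message that Bobby receives, if his secret choice is `ω`. -/
def lastMessage (G : Bobby Q Ω) (E : Evelyn Q t) (ω : Ω) : Matrix Q Q ℂ :=
  E.last.map (pureState (G.challenge ω) ⊗ₖ stateAfter G E ω (Fin.last t))

/-- The probability that Bobby's test passes: the average, over his uniformly random secret choice
`ω`, of the probability that measuring the last message gives `answer ω`. -/
noncomputable def passProb (G : Bobby Q Ω) (E : Evelyn Q t) : ℝ :=
  (∑ ω : Ω, (lastMessage G E ω (G.answer ω) (G.answer ω)).re) / Fintype.card Ω

end Play

/-- The parallel `s`-fold repetition: `s` independent copies of Bobby, each with his own secret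
choice, act side by side on the `s` registers of a joint message in each round (all vectors and
gates are tensor products), and the test passes if and only if all `s` tests pass. Evelyn may act
jointly on all registers. -/
def Bobby.parallel {Q Ω : Type} (G : Bobby Q Ω) (s : ℕ) : Bobby (Fin s → Q) (Fin s → Ω) where
  first := fun q => ∏ j, G.first (q j)
  gate := fun ω => Matrix.of fun q q' => ∏ j, G.gate (ω j) (q j) (q' j)
  challenge := fun ω q => ∏ j, G.challenge (ω j) (q j)
  answer := fun ω j => G.answer (ω j)

/-- The phase `φ_x = 2πx / (2r+1)`, where `k : Fin (2r+1)` stands for `x = k + 1` in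
`{1, …, 2r+1}`. -/
noncomputable def phase (r : ℕ) (k : Fin (2 * r + 1)) : ℝ :=
  2 * Real.pi * ((k : ℝ) + 1) / (2 * (r : ℝ) + 1)

/-- Bobby's actions in the single-iteration game. His secret choices are a uniformly random `x` and
an independent uniformly random bit `b`. -/
noncomputable def bobby (r : ℕ) : Bobby (Fin 2) (Fin (2 * r + 1) × Fin 2) where
  first := ![1, 0]
  gate := fun ω => !![1, 0; 0, Complex.exp (Complex.I * (phase r ω.1 : ℂ))]
  challenge := fun ω =>
    ![1 / (Real.sqrt 2 : ℂ),
      (-1) ^ (ω.2 : ℕ) * Complex.exp (Complex.I * (phase r ω.1 : ℂ)) / (Real.sqrt 2 : ℂ)]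
  answer := fun ω => ω.2

end PhaseGame

/-! Bobby's secret enters only through characters of a finite abelian group `K`, here ℤ/(2r+1): a
message with basis label `q` shifts a phase count by the weight of `q`. Evelyn's state is therefore
determined by one secret-independent state carrying a coherent `K`-register, supported on the counts
reachable so far (`exists_blocks`). Averaging over the secrets with a given answer keeps only
coherences between equal total counts (`sum_challenge_kronecker`).

Both bounds come from one nonnegative vector `amp` on `K`, nonzero on every reachable count, which
on its support is an eigenvector of the operator averaging over differences of two weights; the
eigenvalue is `lam`. For the upper bound, weighted Cauchy–Schwarz, a form of semidefinite duality,
dominates the averaged states for all answers by a single operator (`posSemidef_dominating_sub`),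
whose trace the eigenvalue equation computes. For the lower bound, Evelyn prepares `amp` as a
superposition of counts, and her success probability is its Rayleigh quotient, again `lam`.

These data are closed under tensor products: `amp` becomes a product eigenvector, with eigenvalue
`lam ^ s`, so the value is multiplicative. In the single game the eigenvector lives on a path with t
+ 1 vertices (a sine) if t < 2r, and on the full cycle (a constant) otherwise. -/

namespace PhaseGame

/-! ### Completely positive maps, ancillas and Kraus operators. -/

section Channels

variable {A B : Type}

/-- The operator `⟨k| σ |k'⟩` on `A` obtained from an operator on `A` and an ancilla. -/
def block {R : Type} (σ : Matrix (A × R) (A × R) ℂ) (k k' : R) : Matrix A A ℂ :=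
  Matrix.of fun a a' => σ (a, k) (a', k')

variable [Fintype A] [Fintype B]

theorem trace_eq_sum_trace_block {R : Type} [Fintype R] (σ : Matrix (A × R) (A × R) ℂ) :
    σ.trace = ∑ k, (block σ k k).trace := by
  simp only [Matrix.trace, Fintype.sum_prod_type, Matrix.diag_apply, block, Matrix.of_apply]
  exact Finset.sum_comm

theorem Channel.posSemidef_tensorId (Φ : Channel A B) {R : Type} [Fintype R]
    {ρ : Matrix (A × R) (A × R) ℂ} (hρ : ρ.PosSemidef) : (tensorId Φ.map R ρ).PosSemidef := by
  let e := Fintype.equivFin R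
  have h := Φ.completelyPositive _ _ (hρ.submatrix (Prod.map id e.symm))
  have h' := h.submatrix (Prod.map (id : B → B) e)
  convert h' using 1
  ext p q
  simp [tensorId]

theorem Channel.posSemidef_map (Φ : Channel A B) {ρ : Matrix A A ℂ} (hρ : ρ.PosSemidef) :
    (Φ.map ρ).PosSemidef :=
  (Φ.posSemidef_tensorId (R := Unit) (hρ.submatrix Prod.fst)).submatrix fun b => (b, ())

theorem Channel.trace_tensorId (Φ : Channel A B) {R : Type} [Fintype R]
    (ρ : Matrix (A × R) (A × R) ℂ) : (tensorId Φ.map R ρ).trace = ρ.trace := by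
  rw [trace_eq_sum_trace_block, trace_eq_sum_trace_block]
  exact Finset.sum_congr rfl fun k _ => Φ.tracePreserving (block ρ k k)

/-- The quantum operation with given Kraus operators. -/
def Channel.ofKraus [DecidableEq A] {ι : Type} [Fintype ι] (V : ι → Matrix B A ℂ)
    (hV : ∑ j, (V j)ᴴ * V j = 1) : Channel A B where
  map :=
    { toFun := fun ρ => ∑ j, V j * ρ * (V j)ᴴ
      map_add' := fun ρ ρ' => by simp [Matrix.mul_add, Matrix.add_mul, Finset.sum_add_distrib]
      map_smul' := fun c ρ => by simp [Finset.smul_sum] }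
  completelyPositive n ρ hρ := by
    have h : ∀ Φ : Matrix A A ℂ →ₗ[ℂ] Matrix B B ℂ, (∀ ρ, Φ ρ = ∑ j, V j * ρ * (V j)ᴴ) →
        tensorId Φ (Fin n) ρ = ∑ j, (V j ⊗ₖ (1 : Matrix (Fin n) (Fin n) ℂ)) * ρ *
          (V j ⊗ₖ (1 : Matrix (Fin n) (Fin n) ℂ))ᴴ := by
      intro Φ hΦ
      ext p q
      simp [tensorId, hΦ, Matrix.sum_apply, Matrix.mul_apply, Fintype.sum_prod_type,
        Matrix.one_apply, apply_ite]
    rw [h _ fun ρ => rfl]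
    exact Matrix.posSemidef_sum _ fun j _ => hρ.mul_mul_conjTranspose_same _
  tracePreserving ρ := by
    have h : ∀ j, (V j * ρ * (V j)ᴴ).trace = ((V j)ᴴ * V j * ρ).trace := fun j => by
      rw [Matrix.trace_mul_comm, Matrix.mul_assoc]
    simp only [LinearMap.coe_mk, AddHom.coe_mk]
    rw [Matrix.trace_sum, Finset.sum_congr rfl fun j _ => h j, ← Matrix.trace_sum,
      ← Finset.sum_mul, hV, Matrix.one_mul]

theorem Channel.ofKraus_map_pureState [DecidableEq A] {ι : Type} [Fintype ι]
    (V : ι → Matrix B A ℂ) (hV : ∑ j, (V j)ᴴ * V j = 1) (ψ : A → ℂ) :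
    (Channel.ofKraus V hV).map (pureState ψ) = ∑ j, pureState (V j *ᵥ ψ) := by
  simp [Channel.ofKraus, pureState, Matrix.mul_vecMulVec, Matrix.vecMulVec_mul,
    Matrix.star_mulVec]

end Channels

/-- Cauchy–Schwarz with weights `f` of total at most 1. Bounding `‖v a‖ ^ 2` by a product, rather
than dividing by `d a`, allows zeros of `d`. -/
theorem posSemidef_diagonal_sub_vecMulVec {A : Type} [Fintype A] [DecidableEq A] (v : A → ℂ)
    (d f : A → ℝ) (hd : ∀ a, 0 ≤ d a) (hf : ∀ a, 0 ≤ f a) (hsum : ∑ a, f a ≤ 1)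
    (hv : ∀ a, ‖v a‖ ^ 2 ≤ f a * d a) :
    (Matrix.diagonal (fun a => (d a : ℂ)) - Matrix.vecMulVec v (star v)).PosSemidef := by
  refine Matrix.PosSemidef.of_dotProduct_mulVec_nonneg ?_ fun x => ?_
  · refine Matrix.IsHermitian.sub ?_ (Matrix.posSemidef_vecMulVec_self_star v).1
    exact Matrix.isHermitian_diagonal_of_self_adjoint _ (by ext a; simp)
  · have h : star x ⬝ᵥ ((Matrix.diagonal (fun a => (d a : ℂ)) - Matrix.vecMulVec v (star v)) *ᵥ x) =
        ((∑ a, d a * ‖x a‖ ^ 2 - ‖∑ a, star (v a) * x a‖ ^ 2 : ℝ) : ℂ) := by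
      rw [Matrix.sub_mulVec, dotProduct_sub]
      push_cast
      congr 1
      · refine Finset.sum_congr rfl fun a _ => ?_
        rw [Matrix.mulVec_diagonal, ← Complex.conj_mul']
        simp only [Pi.star_apply, RCLike.star_def]
        ring
      · rw [← Complex.conj_mul', Matrix.vecMulVec_mulVec, dotProduct_smul]
        simp [dotProduct, map_sum, mul_comm]
    rw [h]
    norm_cast
    have h1 : ‖∑ a, star (v a) * x a‖ ≤ ∑ a, ‖v a‖ * ‖x a‖ :=
      (norm_sum_le _ _).trans_eq (by simp)
    have h2 : (∑ a, ‖v a‖ * ‖x a‖) ^ 2 ≤ (∑ a, f a) * ∑ a, d a * ‖x a‖ ^ 2 := by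
      refine Finset.sum_sq_le_sum_mul_sum_of_sq_le_mul _ (fun a _ => hf a)
        (fun a _ => mul_nonneg (hd a) (sq_nonneg _)) fun a _ => ?_
      rw [mul_pow, ← mul_assoc]
      exact mul_le_mul_of_nonneg_right (hv a) (sq_nonneg _)
    have h3 : (∑ a, f a) * ∑ a, d a * ‖x a‖ ^ 2 ≤ ∑ a, d a * ‖x a‖ ^ 2 :=
      mul_le_of_le_one_left (Finset.sum_nonneg fun a _ => mul_nonneg (hd a) (sq_nonneg _)) hsum
    have h4 := pow_le_pow_left₀ (norm_nonneg _) h1 2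
    linarith

theorem diagonal_kronecker_conj_apply {Q M : Type} [Fintype Q] [DecidableEq Q] [Fintype M]
    [DecidableEq M] (d : Q → ℂ) (ρ : Matrix (Q × M) (Q × M) ℂ) (y y' : Q × M) :
    ((Matrix.diagonal d ⊗ₖ (1 : Matrix M M ℂ)) * ρ * (Matrix.diagonal d ⊗ₖ (1 : Matrix M M ℂ))ᴴ)
      y y' = d y.1 * ρ y y' * star (d y'.1) := by
  rw [← Matrix.diagonal_one, Matrix.diagonal_kronecker_diagonal, Matrix.diagonal_conjTranspose,
    Matrix.mul_diagonal, Matrix.diagonal_mul]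
  simp

/-- A game in which all of Bobby's actions are diagonal up to characters of a finite group `K`,
together with a vector `amp` on `K` from which both an optimal strategy and a proof of its
optimality are obtained. The number `lam` is the resulting value of the game. -/
structure PhaseCertificate {Q Ω : Type} [Fintype Q] [DecidableEq Q] [Fintype Ω] (G : Bobby Q Ω)
    (t : ℕ) (K : Type) [AddCommGroup K] [Fintype K] [DecidableEq K] (lam : ℝ) where
  start : Q
  weight : Q → K
  char : Ω → AddChar K ℂ
  flat : Matrix Q Q ℂ
  amp : K → ℝ
  reach : ℕ → Set K
  move : ℕ → K → Q
  first_eq : ∀ q, G.first q = if q = start then 1 else 0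
  gate_eq : ∀ ω, G.gate ω = Matrix.diagonal fun q => char ω (weight q)
  challenge_eq : ∀ ω q, G.challenge ω q = flat (G.answer ω) q * char ω (weight q)
  flat_unitary : ∀ a a', ∑ b, flat b a * star (flat b a') = if a = a' then 1 else 0
  flat_norm : ∀ b a, flat b a * star (flat b a) = 1 / Fintype.card Q
  sum_char : ∀ b k, ∑ ω, (if G.answer ω = b then char ω k else 0) =
    if k = 0 then (Fintype.card Ω / Fintype.card Q : ℂ) else 0
  amp_nonneg : ∀ k, 0 ≤ amp k
  amp_sq : ∑ k, amp k ^ 2 = 1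
  amp_eigen : ∀ k, amp k ≠ 0 →
    ∑ a, ∑ a', amp (k + weight a - weight a') = lam * Fintype.card Q ^ 2 * amp k
  reach_zero : 0 ∈ reach 0
  reach_succ : ∀ i k q, k ∈ reach i → k + weight q ∈ reach (i + 1)
  reach_amp : ∀ k, k ∈ reach t → amp k ≠ 0
  move_zero : ∀ k, move 0 k = start
  sum_move : ∀ k, amp k ≠ 0 → ∑ i ∈ Finset.range t, weight (move (i + 1) k) = k

end PhaseGame
-- Upper bound on the passing probability.
namespace PhaseGame
namespace PhaseCertificate

variable {Q Ω : Type} [Fintype Q] [DecidableEq Q] [Fintype Ω] {G : Bobby Q Ω} {t : ℕ}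
  {K : Type} [AddCommGroup K] [Fintype K] [DecidableEq K] {lam : ℝ}

theorem star_char (C : PhaseCertificate G t K lam) (ω : Ω) (k : K) :
    star (C.char ω k) = C.char ω (-k) :=
  (AddChar.map_neg_eq_conj _ _).symm

/-- The phases are recorded coherently in a fictitious register `K`. Evelyn's operations leave it
alone and Bobby's gate shifts it, so `σ` never depends on the secret; the characters are applied
only when the register is removed. -/
theorem exists_blocks (C : PhaseCertificate G t K lam) (E : Evelyn Q t) (i : Fin (t + 1)) :
    ∃ σ : Matrix ((Q × Fin (E.mem i)) × K) ((Q × Fin (E.mem i)) × K) ℂ,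
      σ.PosSemidef ∧ σ.trace = 1 ∧ (∀ y k z, k ∉ C.reach i → σ (y, k) z = 0) ∧
      ∀ ω, stateAfter G E ω i =
        ∑ k, ∑ k', (C.char ω k * star (C.char ω k')) • block σ k k' := by
  induction i using Fin.induction with
  | zero =>
    let u : K → ℂ := fun k => if k = 0 then 1 else 0
    refine ⟨(pureState G.first ⊗ₖ E.init) ⊗ₖ pureState u, ?_, ?_, ?_, ?_⟩
    · exact ((Matrix.posSemidef_vecMulVec_self_star _).kronecker E.init_posSemidef).kronecker
        (Matrix.posSemidef_vecMulVec_self_star _)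
    · rw [Matrix.trace_kronecker, Matrix.trace_kronecker, E.init_trace]
      simp [pureState, Matrix.trace, Matrix.vecMulVec_apply, C.first_eq, u]
    · intro y k z hk
      have : k ≠ 0 := fun h => hk (h ▸ C.reach_zero)
      simp [pureState, Matrix.vecMulVec_apply, u, this]
    · intro ω
      ext y y'
      simp [stateAfter, Matrix.sum_apply, block, pureState, Matrix.vecMulVec_apply, u, apply_ite]
  | succ i ih =>
    obtain ⟨σ, hpos, htr, hsupp, hrep⟩ := ih
    -- Bobby's gate as a shift: the new count `k` comes from `k` minus the weight of the message
    -- just sent.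
    let f : (Q × Fin (E.mem i.succ)) × K → (Q × Fin (E.mem i.succ)) × K :=
      fun y => (y.1, y.2 - C.weight y.1.1)
    refine ⟨(tensorId (E.op i).map K σ).submatrix f f, ?_, ?_, ?_, ?_⟩
    · exact ((E.op i).posSemidef_tensorId hpos).submatrix f
    · rw [← htr, ← (E.op i).trace_tensorId]
      simp only [Matrix.trace, Matrix.diag_apply, Matrix.submatrix_apply]
      rw [Fintype.sum_prod_type (γ := ℂ) (α₂ := K), Fintype.sum_prod_type (γ := ℂ) (α₂ := K)]
      exact Finset.sum_congr rfl fun y _ => Equiv.sum_comp (Equiv.subRight (C.weight y.1))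
        fun k => tensorId (E.op i).map K σ (y, k) (y, k)
    · intro y k z hk
      have hk' : k - C.weight y.1 ∉ C.reach i := fun h => hk (by
        have := C.reach_succ _ _ y.1 h
        rwa [sub_add_cancel] at this)
      have h0 : ∀ k', block σ (k - C.weight y.1) k' = 0 := fun k' => by
        ext a a'
        exact hsupp _ _ _ hk'
      change (E.op i).map (block σ (k - C.weight y.1) (f z).2) _ _ = 0
      rw [h0, map_zero]
      rfl
    · intro ω
      have hstep : stateAfter G E ω i.succ =
          (G.gate ω ⊗ₖ (1 : Matrix (Fin (E.mem i.succ)) (Fin (E.mem i.succ)) ℂ)) *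
            (E.op i).map (stateAfter G E ω i.castSucc) *
          (G.gate ω ⊗ₖ (1 : Matrix (Fin (E.mem i.succ)) (Fin (E.mem i.succ)) ℂ))ᴴ := rfl
      rw [hstep, C.gate_eq]
      ext y y'
      rw [diagonal_kronecker_conj_apply, hrep]
      simp only [map_sum, map_smul, Matrix.sum_apply, Matrix.smul_apply, smul_eq_mul]
      simp only [Finset.mul_sum, Finset.sum_mul]
      symm
      refine Fintype.sum_equiv (Equiv.subRight (C.weight y.1)) _ _ fun k => ?_
      refine Fintype.sum_equiv (Equiv.subRight (C.weight y'.1)) _ _ fun k' => ?_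
      have h1 : C.char ω k = C.char ω (k - C.weight y.1) * C.char ω (C.weight y.1) := by
        rw [← AddChar.map_add_eq_mul, sub_add_cancel]
      have h2 : C.char ω k' = C.char ω (k' - C.weight y'.1) * C.char ω (C.weight y'.1) := by
        rw [← AddChar.map_add_eq_mul, sub_add_cancel]
      rw [h1, h2, star_mul']
      simp only [Equiv.subRight_apply]
      change _ * (E.op i).map (block σ (k - C.weight y.1) (k' - C.weight y'.1)) y y' = _
      ring

/-- The part of the final joint state, conditioned on the answer `b`, in which the phases have
accumulated to `m`. -/
def finalBlock (C : PhaseCertificate G t K lam) {Y : Type} (σ : Matrix (Y × K) (Y × K) ℂ)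
    (b : Q) (m : K) : Matrix (Q × Y) (Q × Y) ℂ :=
  Matrix.of fun p p' => C.flat b p.1 * star (C.flat b p'.1) *
    σ (p.2, m - C.weight p.1) (p'.2, m - C.weight p'.1)

/-- Orthogonality of characters: once the challenge has contributed its own weight, terms with
different total counts on the two sides cancel in the average. -/
theorem sum_challenge_kronecker (C : PhaseCertificate G t K lam) {Y : Type}
    (σ : Matrix (Y × K) (Y × K) ℂ) (ρ : Ω → Matrix Y Y ℂ)
    (hρ : ∀ ω, ρ ω = ∑ k, ∑ k', (C.char ω k * star (C.char ω k')) • block σ k k') (b : Q) :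
    ∑ ω, (if G.answer ω = b then pureState (G.challenge ω) ⊗ₖ ρ ω else 0) =
      (Fintype.card Ω / Fintype.card Q : ℂ) • ∑ m, C.finalBlock σ b m := by
  ext ⟨a, y⟩ ⟨a', y'⟩
  have h1 : ∀ ω, (if G.answer ω = b then pureState (G.challenge ω) ⊗ₖ ρ ω else 0)
      (a, y) (a', y') = ∑ k, ∑ k', C.flat b a * star (C.flat b a') * σ (y, k) (y', k') *
        (if G.answer ω = b then C.char ω (k + C.weight a - C.weight a' - k') else 0) := by
    intro ω
    split_ifs with hb
    · rw [Matrix.kroneckerMap_apply, hρ]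
      simp only [Matrix.sum_apply, Matrix.smul_apply, smul_eq_mul, pureState,
        Matrix.vecMulVec_apply, Pi.star_apply, C.challenge_eq, hb, block, Matrix.of_apply,
        Finset.mul_sum, star_mul', C.star_char]
      refine Finset.sum_congr rfl fun k _ => Finset.sum_congr rfl fun k' _ => ?_
      rw [sub_eq_add_neg, sub_eq_add_neg]
      simp only [AddChar.map_add_eq_mul]
      ring
    · simp
  rw [Matrix.sum_apply, Finset.sum_congr rfl fun ω _ => h1 ω, Finset.sum_comm]
  rw [Matrix.smul_apply, Matrix.sum_apply, smul_eq_mul, Finset.mul_sum]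
  refine Fintype.sum_equiv (Equiv.addRight (C.weight a)) _ _ fun k => ?_
  rw [Finset.sum_comm, Finset.sum_eq_single (k + C.weight a - C.weight a')]
  · rw [← Finset.mul_sum, C.sum_char]
    simp only [sub_self, if_true, finalBlock, Matrix.of_apply, Equiv.coe_addRight,
      add_sub_cancel_right]
    ring
  · intro k' _ hk'
    rw [← Finset.mul_sum, C.sum_char, if_neg (sub_ne_zero.2 hk'.symm), mul_zero]
  · simp

/-- The weight of the diagonal block `a` in the operator that dominates `finalBlock`. -/
noncomputable def gain (C : PhaseCertificate G t K lam) (m : K) (a : Q) : ℝ :=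
  (∑ a', C.amp (m - C.weight a')) / C.amp (m - C.weight a)

theorem sum_gain (C : PhaseCertificate G t K lam) {k : K} (hk : C.amp k ≠ 0) :
    ∑ a, C.gain (k + C.weight a) a = lam * Fintype.card Q ^ 2 := by
  simp only [gain, add_sub_cancel_right]
  rw [← Finset.sum_div, C.amp_eigen k hk, mul_div_cancel_right₀ _ hk]

/-- A block diagonal operator, independent of the answer, that dominates `finalBlock`. -/
noncomputable def dominating (C : PhaseCertificate G t K lam) {Y : Type}
    (σ : Matrix (Y × K) (Y × K) ℂ) (m : K) : Matrix (Q × Y) (Q × Y) ℂ :=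
  Matrix.of fun p p' => if p.1 = p'.1 then ((C.gain m p.1 / Fintype.card Q : ℝ) : ℂ) *
    σ (p.2, m - C.weight p.1) (p'.2, m - C.weight p'.1) else 0

/-- All entries of `flat` have the same modulus, so one diagonal operator dominates its rank-one
projectors for every `b`. The Schur product theorem transfers this to the blocks of `σ`. -/
theorem posSemidef_dominating_sub (C : PhaseCertificate G t K lam) {Y : Type}
    {σ : Matrix (Y × K) (Y × K) ℂ} (hσ : σ.PosSemidef)
    (hsupp : ∀ y k z, k ∉ C.reach t → σ (y, k) z = 0) (b : Q) (m : K) :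
    (C.dominating σ m - C.finalBlock σ b m).PosSemidef := by
  -- Where `amp` vanishes, `gain` is 0 by division by zero, so `v` must vanish as well. The change
  -- is harmless: `σ` has no support on those counts.
  let v : Q → ℂ := fun a => if C.amp (m - C.weight a) = 0 then 0 else C.flat b a
  have hS : 0 ≤ ∑ a', C.amp (m - C.weight a') := Finset.sum_nonneg fun _ _ => C.amp_nonneg _
  have hA := posSemidef_diagonal_sub_vecMulVec v (fun a => C.gain m a / Fintype.card Q)
    (fun a => C.amp (m - C.weight a) / ∑ a', C.amp (m - C.weight a'))
    (fun a => div_nonneg (div_nonneg hS (C.amp_nonneg _)) (Nat.cast_nonneg _))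
    (fun a => div_nonneg (C.amp_nonneg _) hS)
    -- The bound is 1 rather than an equality because all amplitudes in the sum may vanish, giving
    -- 0/0 = 0.
    (by rw [← Finset.sum_div]; exact div_self_le_one _) fun a => by
      by_cases ha : C.amp (m - C.weight a) = 0
      · simp [v, ha]
      · have h1 : 0 < ∑ a', C.amp (m - C.weight a') :=
          ((C.amp_nonneg _).lt_of_ne' ha).trans_le
            (Finset.single_le_sum (f := fun a' => C.amp (m - C.weight a'))
              (fun _ _ => C.amp_nonneg _) (Finset.mem_univ a))
        have h2 : ‖C.flat b a‖ ^ 2 = 1 / Fintype.card Q := by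
          have h := C.flat_norm b a
          rw [RCLike.star_def, Complex.mul_conj'] at h
          exact Complex.ofReal_injective (by simpa using h)
        refine le_of_eq ?_
        simp only [v, if_neg ha, h2, gain]
        field_simp
  have hB := hσ.submatrix fun p : Q × Y => (p.2, m - C.weight p.1)
  have hmul := (hA.submatrix (Prod.fst : Q × Y → Q)).hadamard hB
  refine Eq.mp (congrArg Matrix.PosSemidef ?_) hmul
  refine Matrix.ext fun ⟨a, y⟩ ⟨a', y'⟩ => ?_
  have hz : ∀ a, C.amp (m - C.weight a) = 0 → m - C.weight a ∉ C.reach t :=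
    fun a ha h => C.reach_amp _ h ha
  have hcol : ∀ y k z, k ∉ C.reach t → σ z (y, k) = 0 := fun y k z hk => by
    rw [← hσ.1.apply, hsupp y k z hk, star_zero]
  have hfin : C.flat b a * star (C.flat b a') * σ (y, m - C.weight a) (y', m - C.weight a') =
      v a * star (v a') * σ (y, m - C.weight a) (y', m - C.weight a') := by
    by_cases ha : C.amp (m - C.weight a) = 0
    · rw [hsupp _ _ _ (hz a ha), mul_zero, mul_zero]
    by_cases ha' : C.amp (m - C.weight a') = 0
    · rw [hcol _ _ _ (hz a' ha'), mul_zero, mul_zero]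
    simp only [v, if_neg ha, if_neg ha']
  simp only [Matrix.sub_apply, dominating, finalBlock, Matrix.of_apply, hfin,
    Matrix.hadamard_apply, Matrix.submatrix_apply, Matrix.diagonal_apply, Matrix.vecMulVec_apply,
    Pi.star_apply]
  split_ifs <;> ring

theorem trace_dominating (C : PhaseCertificate G t K lam) {Y : Type} [Fintype Y]
    (σ : Matrix (Y × K) (Y × K) ℂ) (m : K) :
    (C.dominating σ m).trace = ∑ a, ((C.gain m a / Fintype.card Q : ℝ) : ℂ) *
      (block σ (m - C.weight a) (m - C.weight a)).trace := by
  simp [Matrix.trace, Fintype.sum_prod_type, dominating, block, Finset.mul_sum]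

/-- After the substitution m = k + weight a, the gains at a fixed count `k` in the support of `amp`
add up to a constant by the eigenvalue equation. Elsewhere the block of `σ` is zero, so the equation
is not needed there. -/
theorem sum_trace_dominating (C : PhaseCertificate G t K lam) [Nonempty Q] {Y : Type} [Fintype Y]
    {σ : Matrix (Y × K) (Y × K) ℂ} (htr : σ.trace = 1)
    (hsupp : ∀ y k z, k ∉ C.reach t → σ (y, k) z = 0) :
    ∑ m, (C.dominating σ m).trace = ((lam * Fintype.card Q : ℝ) : ℂ) := by
  simp only [trace_dominating]
  rw [Finset.sum_comm]
  have h : ∀ a, ∑ m, ((C.gain m a / Fintype.card Q : ℝ) : ℂ) *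
      (block σ (m - C.weight a) (m - C.weight a)).trace =
      ∑ k, ((C.gain (k + C.weight a) a / Fintype.card Q : ℝ) : ℂ) * (block σ k k).trace := by
    intro a
    symm
    refine Fintype.sum_equiv (Equiv.addRight (C.weight a)) _ _ fun k => ?_
    simp
  rw [Finset.sum_congr rfl fun a _ => h a, Finset.sum_comm]
  have h2 : ∀ k, ∑ a, ((C.gain (k + C.weight a) a / Fintype.card Q : ℝ) : ℂ) *
      (block σ k k).trace = ((lam * Fintype.card Q : ℝ) : ℂ) * (block σ k k).trace := by
    intro k
    by_cases hk : C.amp k = 0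
    · have : (block σ k k).trace = 0 :=
        Finset.sum_eq_zero fun y _ => hsupp _ _ _ fun h => C.reach_amp _ h hk
      simp [this]
    · rw [← Finset.sum_mul, ← Complex.ofReal_sum, ← Finset.sum_div, C.sum_gain hk]
      congr 2
      have : (Fintype.card Q : ℝ) ≠ 0 := by simp
      field_simp
  rw [Finset.sum_congr rfl fun k _ => h2 k, ← Finset.mul_sum, ← trace_eq_sum_trace_block, htr,
    mul_one]

/-- Positivity of the last operation preserves the domination. As the dominating operator does not
depend on `b`, summing its outcome probabilities over `b` gives a trace, which the operation
preserves. -/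
theorem passProb_le (C : PhaseCertificate G t K lam) [Nonempty Ω] (E : Evelyn Q t) :
    passProb G E ≤ lam := by
  obtain ⟨σ, hpos, htr, hsupp, hrep⟩ := C.exists_blocks E (Fin.last t)
  have : Nonempty Q := ⟨C.start⟩
  have hQ : (0 : ℝ) < Fintype.card Q := by exact_mod_cast Fintype.card_pos
  have hΩ : (0 : ℝ) < Fintype.card Ω := by exact_mod_cast Fintype.card_pos
  have h1 : ∑ ω, lastMessage G E ω (G.answer ω) (G.answer ω) =
      ∑ b, ∑ m, (Fintype.card Ω / Fintype.card Q : ℂ) * E.last.map (C.finalBlock σ b m) b b := by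
    have h : ∀ ω, lastMessage G E ω (G.answer ω) (G.answer ω) =
        ∑ b, E.last.map (if G.answer ω = b then
          pureState (G.challenge ω) ⊗ₖ stateAfter G E ω (Fin.last t) else 0) b b := by
      intro ω
      rw [Finset.sum_eq_single (G.answer ω)]
      · simp [lastMessage]
      · intro b _ hb
        simp [hb.symm]
      · simp
    rw [Finset.sum_congr rfl fun ω _ => h ω, Finset.sum_comm]
    refine Finset.sum_congr rfl fun b _ => ?_
    rw [← Matrix.sum_apply, ← map_sum, C.sum_challenge_kronecker σ _ hrep b, map_smul, map_sum,
      Matrix.smul_apply, Matrix.sum_apply, smul_eq_mul, Finset.mul_sum]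
  have h2 : ∀ b m, (E.last.map (C.finalBlock σ b m) b b).re ≤
      (E.last.map (C.dominating σ m) b b).re := by
    intro b m
    have h := (E.last.posSemidef_map
      (C.posSemidef_dominating_sub hpos hsupp b m)).diag_nonneg (i := b)
    rw [map_sub, Matrix.sub_apply, sub_nonneg] at h
    exact (Complex.le_def.1 h).1
  have h3 : ∑ b, ∑ m, (E.last.map (C.dominating σ m) b b).re = lam * Fintype.card Q := by
    rw [Finset.sum_comm]
    have h := congrArg Complex.re (C.sum_trace_dominating htr hsupp)
    rw [Complex.ofReal_re, Complex.re_sum] at h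
    rw [← h]
    refine Finset.sum_congr rfl fun m _ => ?_
    rw [← E.last.tracePreserving, Matrix.trace, Complex.re_sum]
    rfl
  have h4 : ∑ ω, (lastMessage G E ω (G.answer ω) (G.answer ω)).re =
      (Fintype.card Ω / Fintype.card Q : ℝ) *
        ∑ b, ∑ m, (E.last.map (C.finalBlock σ b m) b b).re := by
    rw [← Complex.re_sum, h1]
    simp only [Complex.re_sum, Finset.mul_sum]
    refine Finset.sum_congr rfl fun b _ => Finset.sum_congr rfl fun m _ => ?_
    rw [← Complex.re_ofReal_mul]
    push_cast
    rfl
  rw [passProb, div_le_iff₀ hΩ, h4]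
  calc _ ≤ (Fintype.card Ω / Fintype.card Q : ℝ) * (lam * Fintype.card Q) := by
        rw [← h3]
        exact mul_le_mul_of_nonneg_left
          (Finset.sum_le_sum fun b _ => Finset.sum_le_sum fun m _ => h2 b m) (by positivity)
    _ = _ := by field_simp

end PhaseCertificate
end PhaseGame
-- An optimal strategy.
namespace PhaseGame

/-- The quantum operation that permutes the basis. -/
def Channel.ofPerm {A : Type} [Fintype A] [DecidableEq A] (π : Equiv.Perm A) : Channel A A :=
  Channel.ofKraus (fun _ : Unit => Matrix.of fun y y' => if π y = y' then (1 : ℂ) else 0) (by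
    ext a a'
    simp only [Finset.univ_unique, Finset.sum_singleton, Matrix.mul_apply,
      Matrix.conjTranspose_apply, Matrix.of_apply]
    rw [Equiv.sum_comp π fun y => star (if y = a then (1 : ℂ) else 0) * if y = a' then 1 else 0]
    simp [Matrix.one_apply, apply_ite, eq_comm])

theorem Channel.ofPerm_map_pureState {A : Type} [Fintype A] [DecidableEq A] (π : Equiv.Perm A)
    (ψ : A → ℂ) : (Channel.ofPerm π).map (pureState ψ) = pureState fun a => ψ (π a) := by
  rw [Channel.ofPerm, Channel.ofKraus_map_pureState]
  simp only [Finset.univ_unique, Finset.sum_singleton]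
  congr 1
  ext a
  simp [Matrix.mulVec, dotProduct]

theorem pureState_kronecker {A B : Type} (ψ : A → ℂ) (χ : B → ℂ) :
    pureState ψ ⊗ₖ pureState χ = pureState fun p : A × B => ψ p.1 * χ p.2 := by
  ext p p'
  simp only [pureState, Matrix.kroneckerMap_apply, Matrix.vecMulVec_apply, Pi.star_apply,
    star_mul']
  ring

namespace PhaseCertificate

variable {Q Ω : Type} [Fintype Q] [DecidableEq Q] [Fintype Ω] {G : Bobby Q Ω} {t : ℕ}
  {K : Type} [AddCommGroup K] [Fintype K] [DecidableEq K] {lam : ℝ}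

/-- The label of the memory state that stores the phase count `k`. -/
noncomputable def label (K : Type) [Fintype K] : Fin (Fintype.card K) ≃ K :=
  (Fintype.equivFin K).symm

/-- Replaces the previous message by the next one, conditioned on the memory. -/
noncomputable def movePerm (C : PhaseCertificate G t K lam) (i : ℕ) :
    Equiv.Perm (Q × Fin (Fintype.card K)) :=
  Equiv.prodCongrLeft fun z => Equiv.swap (C.move i (label K z)) (C.move (i + 1) (label K z))

/-- What is discarded at the end: the returned message, reset by means of the memory, and the total
phase count. -/
noncomputable def discarded (C : PhaseCertificate G t K lam)
    (y : Q × (Q × Fin (Fintype.card K))) : Q × K :=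
  (Equiv.swap C.start (C.move t (label K y.2.2)) y.2.1, label K y.2.2 + C.weight y.1)

/-- Nothing is lost between the challenge label and the discarded part; this is what makes the final
Kraus operators complete. -/
theorem discarded_eq_iff (C : PhaseCertificate G t K lam)
    (y y' : Q × (Q × Fin (Fintype.card K))) :
    (y.1 = y'.1 ∧ C.discarded y = C.discarded y') ↔ y = y' := by
  obtain ⟨a, q, z⟩ := y
  obtain ⟨a', q', z'⟩ := y'
  refine ⟨?_, by rintro ⟨⟩; simp⟩
  rintro ⟨rfl, h⟩
  simp only [discarded, Prod.mk.injEq, add_left_inj, EmbeddingLike.apply_eq_iff_eq] at h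
  obtain ⟨h1, rfl⟩ := h
  simpa using h1

/-- Kraus operators of the final measurement in the basis given by `flat`. -/
noncomputable def finalKraus (C : PhaseCertificate G t K lam) (j : Q × K) :
    Matrix Q (Q × (Q × Fin (Fintype.card K))) ℂ :=
  Matrix.of fun b y => if C.discarded y = j then star (C.flat b y.1) else 0

theorem sum_finalKraus (C : PhaseCertificate G t K lam) :
    ∑ j, (C.finalKraus j)ᴴ * C.finalKraus j = 1 := by
  ext y y'
  have h : ∀ j, ((C.finalKraus j)ᴴ * C.finalKraus j) y y' =
      if C.discarded y = j then
        if C.discarded y' = j then if y.1 = y'.1 then 1 else 0 else 0 else 0 := by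
    intro j
    rw [← C.flat_unitary]
    simp only [Matrix.mul_apply, Matrix.conjTranspose_apply, finalKraus, Matrix.of_apply]
    split_ifs <;> simp
  rw [Matrix.sum_apply, Finset.sum_congr rfl fun j _ => h j, Finset.sum_ite_eq,
    if_pos (Finset.mem_univ _), Matrix.one_apply]
  rw [← ite_and]
  exact if_congr ((and_congr_left' eq_comm).trans and_comm |>.trans (C.discarded_eq_iff y y'))
    rfl rfl

/-- The strategy that keeps the superposition `amp` of phase counts in memory and collects the
corresponding phases. -/
noncomputable def strategy (C : PhaseCertificate G t K lam) : Evelyn Q t where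
  mem _ := Fintype.card K
  init := pureState fun z => (C.amp (label K z) : ℂ)
  init_posSemidef := Matrix.posSemidef_vecMulVec_self_star _
  init_trace := by
    simp only [pureState, Matrix.trace, Matrix.diag_apply, Matrix.vecMulVec_apply, Pi.star_apply]
    rw [Equiv.sum_comp (label K) fun k => (C.amp k : ℂ) * star (C.amp k : ℂ)]
    simp only [RCLike.star_def, Complex.conj_ofReal, ← sq]
    exact_mod_cast C.amp_sq
  op i := Channel.ofPerm (C.movePerm i)
  last := Channel.ofKraus C.finalKraus C.sum_finalKraus

/-- The joint state of message and memory after `i` rounds of `strategy`. -/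
noncomputable def joint (C : PhaseCertificate G t K lam) (ω : Ω) (i : ℕ)
    (y : Q × Fin (Fintype.card K)) : ℂ :=
  if y.1 = C.move i (label K y.2) then
    C.char ω (∑ i' ∈ Finset.range i, C.weight (C.move (i' + 1) (label K y.2))) *
      C.amp (label K y.2)
  else 0

theorem stateAfter_strategy (C : PhaseCertificate G t K lam) (ω : Ω) (i : Fin (t + 1)) :
    stateAfter G C.strategy ω i = pureState (C.joint ω i) := by
  induction i using Fin.induction with
  | zero =>
    change pureState G.first ⊗ₖ pureState _ = _
    refine (pureState_kronecker _ _).trans (congrArg pureState (funext fun y => ?_))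
    simp [joint, C.first_eq, C.move_zero]
  | succ i ih =>
    change (G.gate ω ⊗ₖ (1 : Matrix (Fin (Fintype.card K)) (Fin (Fintype.card K)) ℂ)) *
      (Channel.ofPerm (C.movePerm i)).map (stateAfter G C.strategy ω i.castSucc) *
      (G.gate ω ⊗ₖ (1 : Matrix (Fin (Fintype.card K)) (Fin (Fintype.card K)) ℂ))ᴴ = _
    rw [ih]
    erw [Channel.ofPerm_map_pureState]
    rw [C.gate_eq]
    ext y y'
    rw [diagonal_kronecker_conj_apply]
    have h : ∀ y, C.joint ω i.succ y =
        C.char ω (C.weight y.1) * C.joint ω i.castSucc (C.movePerm i y) := by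
      intro y
      have hy : C.movePerm i y = (Equiv.swap (C.move i (label K y.2))
        (C.move (i + 1) (label K y.2)) y.1, y.2) := rfl
      simp only [joint, hy, Fin.val_succ, Fin.val_castSucc]
      have hiff : Equiv.swap (C.move i (label K y.2)) (C.move (i + 1) (label K y.2)) y.1 =
          C.move i (label K y.2) ↔ y.1 = C.move (i + 1) (label K y.2) := by
        rw [Equiv.swap_apply_eq_iff, Equiv.swap_apply_left]
      simp only [hiff]
      split_ifs with h1
      · rw [Finset.sum_range_succ, AddChar.map_add_eq_mul, h1]
        ring
      · simp
    simp only [pureState, Matrix.vecMulVec_apply, Pi.star_apply, h, star_mul']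
    ring

/-- On the correct answer the entries of `flat` cancel in modulus, and all paths to the same total
count interfere constructively. The secret survives only as a global phase. -/
theorem finalKraus_mulVec (C : PhaseCertificate G t K lam) (ω : Ω) (j : Q × K) :
    (C.finalKraus j *ᵥ fun p => G.challenge ω p.1 * C.joint ω t p.2) (G.answer ω) =
      if j.1 = C.start then
        C.char ω j.2 * ((1 / Fintype.card Q * ∑ a, C.amp (j.2 - C.weight a) : ℝ) : ℂ) else 0 := by
  have hcq : ∀ a z, ∑ q, C.finalKraus j (G.answer ω) (a, (q, z)) *
      (G.challenge ω a * C.joint ω t (q, z)) =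
      if j.1 = C.start then if label K z = j.2 - C.weight a then
        C.char ω j.2 * (1 / Fintype.card Q * C.amp (j.2 - C.weight a)) else 0 else 0 := by
    intro a z
    rw [Finset.sum_eq_single (C.move t (label K z))]
    -- The moves are required to produce the count only where `amp` is nonzero; elsewhere both sides
    -- vanish.
    · have h1 : C.char ω (∑ i' ∈ Finset.range t, C.weight (C.move (i' + 1) (label K z))) *
          C.amp (label K z) = C.char ω (label K z) * C.amp (label K z) := by
        by_cases hz : C.amp (label K z) = 0
        · simp [hz]
        · rw [C.sum_move _ hz]
      simp only [joint, if_true, h1, finalKraus, discarded, Matrix.of_apply,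
        Equiv.swap_apply_right, C.challenge_eq]
      by_cases hs : j.1 = C.start
      · by_cases hz : label K z = j.2 - C.weight a
        · have hj : C.char ω j.2 = C.char ω (j.2 - C.weight a) * C.char ω (C.weight a) := by
            rw [← AddChar.map_add_eq_mul, sub_add_cancel]
          rw [if_pos hs, if_pos hz, if_pos (by rw [hz, sub_add_cancel, ← hs]), hz, hj,
            ← C.flat_norm (G.answer ω) a]
          ring
        · rw [if_pos hs, if_neg hz, if_neg, zero_mul]
          rintro rfl
          exact hz (by simp)
      · rw [if_neg hs, if_neg, zero_mul]
        rintro rfl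
        exact hs rfl
    · intro q _ hq
      simp [joint, hq]
    · simp
  have hz : ∀ a, ∑ q, ∑ z, C.finalKraus j (G.answer ω) (a, (q, z)) *
      (G.challenge ω a * C.joint ω t (q, z)) =
      if j.1 = C.start then
        C.char ω j.2 * (1 / Fintype.card Q * C.amp (j.2 - C.weight a)) else 0 := by
    intro a
    rw [Finset.sum_comm, Finset.sum_congr rfl fun z _ => hcq a z,
      Equiv.sum_comp (label K) fun k => if j.1 = C.start then if k = j.2 - C.weight a then
        C.char ω j.2 * (1 / Fintype.card Q * (C.amp (j.2 - C.weight a) : ℂ)) else 0 else 0]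
    split_ifs <;> simp
  simp only [Matrix.mulVec, dotProduct, Fintype.sum_prod_type]
  rw [Finset.sum_congr rfl fun a _ => hz a]
  split_ifs
  · push_cast
    simp only [Finset.mul_sum]
  · simp

/-- Expanding the square gives the Rayleigh quotient of the averaging operator at the unit vector
`amp`. -/
theorem sum_sq_average_amp (C : PhaseCertificate G t K lam) :
    ∑ m, (1 / Fintype.card Q * ∑ a, C.amp (m - C.weight a)) ^ 2 = lam := by
  have hQ : (Fintype.card Q : ℝ) ≠ 0 := by
    have : Nonempty Q := ⟨C.start⟩
    simp
  have h1 : ∀ m, (1 / Fintype.card Q * ∑ a, C.amp (m - C.weight a)) ^ 2 =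
      1 / (Fintype.card Q : ℝ) ^ 2 *
        ∑ a, C.amp (m - C.weight a) * ∑ a', C.amp (m - C.weight a') := by
    intro m
    rw [← Finset.sum_mul]
    ring
  have h2 : ∀ a, ∑ m, C.amp (m - C.weight a) * ∑ a', C.amp (m - C.weight a') =
      ∑ k, C.amp k * ∑ a', C.amp (k + C.weight a - C.weight a') := by
    intro a
    refine Fintype.sum_equiv (Equiv.subRight (C.weight a)) _ _ fun m => ?_
    simp
  have h3 : ∀ k, ∑ a, C.amp k * ∑ a', C.amp (k + C.weight a - C.weight a') =
      lam * Fintype.card Q ^ 2 * C.amp k ^ 2 := by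
    intro k
    by_cases hk : C.amp k = 0
    · simp [hk]
    · rw [← Finset.mul_sum, C.amp_eigen k hk]
      ring
  rw [Finset.sum_congr rfl fun m _ => h1 m, ← Finset.mul_sum, Finset.sum_comm,
    Finset.sum_congr rfl fun a _ => h2 a, Finset.sum_comm, Finset.sum_congr rfl fun k _ => h3 k,
    ← Finset.mul_sum, C.amp_sq]
  field_simp

theorem passProb_strategy (C : PhaseCertificate G t K lam) [Nonempty Ω] :
    passProb G C.strategy = lam := by
  have h : ∀ ω, (lastMessage G C.strategy ω (G.answer ω) (G.answer ω)).re = lam := by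
    intro ω
    have h1 : lastMessage G C.strategy ω = ∑ j, pureState
        (C.finalKraus j *ᵥ fun p => G.challenge ω p.1 * C.joint ω t p.2) := by
      rw [lastMessage, stateAfter_strategy]
      erw [pureState_kronecker]
      exact Channel.ofKraus_map_pureState _ C.sum_finalKraus _
    have h2 : ∀ j : Q × K, pureState
        (C.finalKraus j *ᵥ fun p => G.challenge ω p.1 * C.joint ω t p.2)
        (G.answer ω) (G.answer ω) = if j.1 = C.start then
          (((1 / Fintype.card Q * ∑ a, C.amp (j.2 - C.weight a)) ^ 2 : ℝ) : ℂ) else 0 := by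
      intro j
      rw [pureState, Matrix.vecMulVec_apply, Pi.star_apply, C.finalKraus_mulVec]
      split_ifs
      · rw [RCLike.star_def, Complex.mul_conj', norm_mul, AddChar.norm_apply, one_mul,
          Complex.norm_real, Real.norm_eq_abs, ← Complex.ofReal_pow, sq_abs]
      · simp
    rw [h1, Matrix.sum_apply, Finset.sum_congr rfl fun j _ => h2 j, Fintype.sum_prod_type,
      Finset.sum_comm]
    simp only [Finset.sum_ite_eq', Finset.mem_univ, if_true]
    rw [← Complex.ofReal_sum, Complex.ofReal_re, C.sum_sq_average_amp]
  rw [passProb, Finset.sum_congr rfl fun ω _ => h ω]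
  simp

theorem isGreatest (C : PhaseCertificate G t K lam) [Nonempty Ω] :
    IsGreatest (Set.range fun E : Evelyn Q t => passProb G E) lam := by
  refine ⟨⟨C.strategy, C.passProb_strategy⟩, ?_⟩
  rintro _ ⟨E, rfl⟩
  exact C.passProb_le E

end PhaseCertificate
end PhaseGame
-- Tensor powers of certificates.
namespace PhaseGame
namespace PhaseCertificate

variable {Q Ω : Type} [Fintype Q] [DecidableEq Q] [Fintype Ω] {G : Bobby Q Ω} {t : ℕ}
  {K : Type} [AddCommGroup K] [Fintype K] [DecidableEq K] {lam : ℝ}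

theorem sum_pi_prod {R A : Type} [CommSemiring R] [Fintype A] {s : ℕ} (f : Fin s → A → R) :
    ∑ x : Fin s → A, ∏ j, f j (x j) = ∏ j, ∑ a, f j a := by
  rw [Finset.prod_univ_sum, Fintype.piFinset_univ]

theorem prod_ite_one_zero {R A : Type} [CommSemiring R] [DecidableEq A] {s : ℕ} (x y : Fin s → A)
    (r : R) : ∏ j, (if x j = y j then r else 0) = if x = y then r ^ s else 0 := by
  simp [Finset.prod_ite_zero, funext_iff]

/-- Product characters, amplitudes and moves for the parallel repetition. -/
noncomputable def parallel (C : PhaseCertificate G t K lam) (s : ℕ) :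
    PhaseCertificate (G.parallel s) t (Fin s → K) (lam ^ s) where
  start _ := C.start
  weight q j := C.weight (q j)
  char ω :=
    { toFun := fun k => ∏ j, C.char (ω j) (k j)
      map_zero_eq_one' := by simp
      map_add_eq_mul' := fun k k' => by simp [AddChar.map_add_eq_mul, Finset.prod_mul_distrib] }
  flat := Matrix.of fun b a => ∏ j, C.flat (b j) (a j)
  amp k := ∏ j, C.amp (k j)
  reach i := {k | ∀ j, k j ∈ C.reach i}
  move i k j := C.move i (k j)
  first_eq q := by
    simp only [Bobby.parallel, C.first_eq]
    rw [prod_ite_one_zero q fun _ => C.start, one_pow]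
  gate_eq ω := by
    ext q q'
    simp only [Bobby.parallel, C.gate_eq, Matrix.of_apply, Matrix.diagonal_apply,
      Finset.prod_ite_zero, funext_iff]
    simp
  challenge_eq ω q := by
    simp [Bobby.parallel, C.challenge_eq, Finset.prod_mul_distrib]
  flat_unitary a a' := by
    simp only [Matrix.of_apply, star_prod, ← Finset.prod_mul_distrib]
    rw [sum_pi_prod fun j b => C.flat b (a j) * star (C.flat b (a' j))]
    simp only [C.flat_unitary]
    rw [prod_ite_one_zero, one_pow]
  flat_norm b a := by
    simp only [Matrix.of_apply, star_prod, ← Finset.prod_mul_distrib, C.flat_norm]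
    simp
  sum_char b k := by
    have h : ∀ ω : Fin s → Ω, (if (G.parallel s).answer ω = b then
        ∏ j, C.char (ω j) (k j) else 0) =
        ∏ j, if G.answer (ω j) = b j then C.char (ω j) (k j) else 0 := by
      intro ω
      simp [Finset.prod_ite_zero, Bobby.parallel, funext_iff]
    simp only [AddChar.coe_mk, h]
    rw [sum_pi_prod fun j ω => if G.answer ω = b j then C.char ω (k j) else 0]
    simp only [C.sum_char]
    refine (prod_ite_one_zero k 0 _).trans ?_
    simp [div_pow]
  amp_nonneg k := Finset.prod_nonneg fun j _ => C.amp_nonneg _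
  amp_sq := by
    simp only [← Finset.prod_pow]
    rw [sum_pi_prod fun _ k => C.amp k ^ 2]
    simp [C.amp_sq]
  amp_eigen k hk := by
    have hk' : ∀ j, C.amp (k j) ≠ 0 := fun j => (Finset.prod_ne_zero_iff.1 hk) j (Finset.mem_univ j)
    simp only [Pi.add_apply, Pi.sub_apply]
    have h : ∀ a : Fin s → Q,
        ∑ a' : Fin s → Q, ∏ j, C.amp (k j + C.weight (a j) - C.weight (a' j)) =
        ∏ j, ∑ a', C.amp (k j + C.weight (a j) - C.weight a') := fun a =>
      sum_pi_prod fun j a' => C.amp (k j + C.weight (a j) - C.weight a')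
    rw [Finset.sum_congr rfl fun a _ => h a,
      sum_pi_prod fun j a => ∑ a', C.amp (k j + C.weight a - C.weight a'),
      Finset.prod_congr rfl fun j _ => C.amp_eigen (k j) (hk' j), Finset.prod_mul_distrib]
    simp [mul_pow, ← pow_mul, mul_comm]
  reach_zero j := C.reach_zero
  reach_succ i k q hk j := C.reach_succ i _ _ (hk j)
  reach_amp k hk := Finset.prod_ne_zero_iff.2 fun j _ => C.reach_amp _ (hk j)
  move_zero k := funext fun j => C.move_zero _
  sum_move k hk := by
    have hk' : ∀ j, C.amp (k j) ≠ 0 := fun j => (Finset.prod_ne_zero_iff.1 hk) j (Finset.mem_univ j)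
    ext j
    rw [Finset.sum_apply]
    exact C.sum_move _ (hk' j)

end PhaseCertificate

/-! ### The certificate of the single game. -/

theorem exp_phase (r : ℕ) (x : Fin (2 * r + 1)) :
    Complex.exp (Complex.I * (phase r x : ℂ)) =
      ZMod.stdAddChar (((x : ℕ) + 1 : ℕ) : ZMod (2 * r + 1)) := by
  have h := ZMod.stdAddChar_coe (N := 2 * r + 1) (((x : ℕ) + 1 : ℕ) : ℤ)
  rw [Int.cast_natCast] at h
  rw [h]
  congr 1
  simp only [phase]
  push_cast
  ring

/-- The certificate for the phase game from an unnormalized amplitude `c`. -/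
noncomputable def bobbyCertificate (r t : ℕ) (lam : ℝ) (c : ZMod (2 * r + 1) → ℝ)
    (hc : ∀ k, 0 ≤ c k) (hpos : ∀ k : ZMod (2 * r + 1), c k ≠ 0 ↔ k.val ≤ t)
    (heig : ∀ k : ZMod (2 * r + 1), k.val ≤ t →
      2 * c k + c (k + 1) + c (k - 1) = 4 * lam * c k) :
    PhaseCertificate (bobby r) t (ZMod (2 * r + 1)) lam where
  start := 0
  weight q := if q = 0 then 0 else 1
  char ω := ZMod.stdAddChar.mulShift (((ω.1 : ℕ) + 1 : ℕ) : ZMod (2 * r + 1))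
  flat := Matrix.of fun b a => (-1) ^ ((b : ℕ) * (a : ℕ)) / (Real.sqrt 2 : ℂ)
  amp k := c k / Real.sqrt (∑ k, c k ^ 2)
  reach i := {k | k.val ≤ i}
  -- Sending 1 in rounds 1, …, `k.val` and 0 afterwards collects the phase exactly `k.val` times.
  -- Index 0 stands for Bobby's first message.
  move i k := if 0 < i ∧ i ≤ k.val then 1 else 0
  first_eq q := by fin_cases q <;> simp [bobby]
  gate_eq ω := by
    ext q q'
    fin_cases q <;> fin_cases q' <;> simp [bobby, exp_phase, AddChar.mulShift_apply]
  challenge_eq ω q := by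
    fin_cases q
    · simp [bobby]
    · simp [bobby, exp_phase, AddChar.mulShift_apply]
      ring
  flat_unitary a a' := by
    have h2 : (Real.sqrt 2 : ℂ) * (Real.sqrt 2 : ℂ) = 2 := by
      norm_cast
      simp
    fin_cases a <;> fin_cases a' <;> simp [Fin.sum_univ_two] <;> field_simp <;>
      norm_num [sq, h2]
  flat_norm b a := by
    have h2 : (Real.sqrt 2 : ℂ) * (Real.sqrt 2 : ℂ) = 2 := by
      norm_cast
      simp
    fin_cases a <;> fin_cases b <;> simp [div_mul_div_comm, h2] <;> field_simp <;>
      simp [sq, h2]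
  sum_char b k := by
    rw [Fintype.sum_prod_type]
    have hb : ∀ x : Fin (2 * r + 1), ∑ y : Fin 2, (if (bobby r).answer (x, y) = b then
        ZMod.stdAddChar.mulShift (((x : ℕ) + 1 : ℕ) : ZMod (2 * r + 1)) k else 0) =
        ZMod.stdAddChar ((((x : ℕ) + 1 : ℕ) : ZMod (2 * r + 1)) * k) := fun x =>
      (Finset.sum_ite_eq' Finset.univ b _).trans (if_pos (Finset.mem_univ _))
    have h : ∑ x : Fin (2 * r + 1), ZMod.stdAddChar ((((x : ℕ) + 1 : ℕ) : ZMod (2 * r + 1)) * k) =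
        ∑ x : ZMod (2 * r + 1), ZMod.stdAddChar (x * k) := by
      -- The secrets are numbered from 1, so the sum over the cyclic group is translated by 1.
      rw [← Equiv.sum_comp (Equiv.addRight (1 : ZMod (2 * r + 1)))]
      refine Finset.sum_congr rfl fun x _ => ?_
      congr 2
      push_cast
      congr 1
      exact ZMod.natCast_zmod_val (n := 2 * r + 1) x
    rw [Finset.sum_congr rfl fun x _ => hb x, h, AddChar.sum_mulShift k (ZMod.isPrimitive_stdAddChar _)]
    split_ifs <;> simp [ZMod.card]
  amp_nonneg k := div_nonneg (hc k) (Real.sqrt_nonneg _)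
  amp_sq := by
    have h : 0 < ∑ k, c k ^ 2 := Finset.sum_pos' (fun k _ => sq_nonneg _)
      ⟨0, Finset.mem_univ _, pow_pos ((hc 0).lt_of_ne' ((hpos 0).2 (by simp))) 2⟩
    simp only [div_pow, Real.sq_sqrt h.le]
    rw [← Finset.sum_div, div_self h.ne']
  amp_eigen k hk := by
    have h := heig k ((hpos k).1 fun h => hk (by simp [h]))
    simp only [← Finset.sum_div, Fin.sum_univ_two, Fintype.card_fin]
    have h4 : lam * ((2 : ℕ) : ℝ) ^ 2 * (c k / Real.sqrt (∑ k, c k ^ 2)) =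
        (4 * lam * c k) / Real.sqrt (∑ k, c k ^ 2) := by
      push_cast
      ring
    rw [h4, ← h]
    simp only [if_true, one_ne_zero, if_false, add_zero, sub_zero, add_sub_cancel_right]
    ring
  reach_zero := by simp
  reach_succ i k q hk := by
    simp only [Set.mem_ofPred_eq] at hk ⊢
    split_ifs
    · rw [add_zero]
      omega
    · refine (ZMod.val_add_le _ _).trans ?_
      have : (1 : ZMod (2 * r + 1)).val ≤ 1 := by
        rw [ZMod.val_one_eq_one_mod]
        exact Nat.mod_le _ _
      omega
  reach_amp k hk := by
    have h : 0 < ∑ k, c k ^ 2 := Finset.sum_pos' (fun k _ => sq_nonneg _)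
      ⟨0, Finset.mem_univ _, pow_pos ((hc 0).lt_of_ne' ((hpos 0).2 (by simp))) 2⟩
    exact div_ne_zero ((hpos k).2 hk) (Real.sqrt_pos.2 h).ne'
  move_zero k := by simp
  sum_move k hk := by
    have hk' : k.val ≤ t := (hpos k).1 fun h => hk (by simp [h])
    have h : ∀ i ∈ Finset.range t, (if (if 0 < i + 1 ∧ i + 1 ≤ k.val then (1 : Fin 2) else 0) = 0
        then (0 : ZMod (2 * r + 1)) else 1) = if i ∈ Finset.range k.val then 1 else 0 := by
      intro i _
      simp only [Finset.mem_range]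
      by_cases hi : i < k.val
      · simp [hi, Nat.succ_le_of_lt hi]
      · simp [hi]
    rw [Finset.sum_congr rfl h, ← Finset.sum_filter, Finset.filter_mem_eq_inter,
      Finset.inter_eq_right.2 (Finset.range_subset_range.2 hk')]
    simp

/-- The eigenvalue equation is that of a discrete Laplacian. For t < 2r the counts 0, …, t leave a
gap in the cycle, so the boundary values at -1 and t + 1 are zero (possibly the same point). -/
theorem exists_bobbyCertificate (r t : ℕ) :
    ∃ lam : ℝ, Nonempty (PhaseCertificate (bobby r) t (ZMod (2 * r + 1)) lam) := by
  by_cases ht : 2 * r ≤ t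
  · refine ⟨1, ⟨bobbyCertificate r t 1 (fun _ => 1) (fun _ => zero_le_one) (fun k => ?_)
      fun k _ => by norm_num⟩⟩
    have := ZMod.val_lt k
    simp only [ne_eq, one_ne_zero, not_false_eq_true, true_iff]
    omega
  · push Not at ht
    have hθ : 0 < Real.pi / (t + 2) := div_pos Real.pi_pos (by positivity)
    -- The angle is chosen so that sin((k + 1)θ) vanishes at k = -1 and at k = t + 1 and is positive
    -- in between.
    set θ := Real.pi / (t + 2) with hθdef
    have hend : ((t : ℝ) + 2) * θ = Real.pi := by
      rw [hθdef]
      field_simp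
    have hsin : ∀ n : ℕ, n ≤ t → 0 < Real.sin (((n : ℝ) + 1) * θ) := by
      intro n hn
      refine Real.sin_pos_of_pos_of_lt_pi (by positivity) ?_
      rw [← hend]
      have : (n : ℝ) ≤ t := by exact_mod_cast hn
      exact mul_lt_mul_of_pos_right (by linarith) hθ
    let c : ZMod (2 * r + 1) → ℝ :=
      fun k => if k.val ≤ t then Real.sin (((k.val : ℝ) + 1) * θ) else 0
    have hadd : ∀ k : ZMod (2 * r + 1), k.val ≤ t →
        c (k + 1) = Real.sin (((k.val : ℝ) + 2) * θ) := by
      intro k hk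
      have h1 : (1 : ZMod (2 * r + 1)).val = 1 := by
        rw [ZMod.val_one_eq_one_mod, Nat.mod_eq_of_lt (by omega)]
      have hv : (k + 1).val = k.val + 1 := by
        rw [ZMod.val_add_of_lt (by omega), h1]
      simp only [c, hv]
      split_ifs with h
      · push_cast
        ring_nf
      · have : k.val = t := by omega
        rw [this, hend, Real.sin_pi]
    have hsub : ∀ k : ZMod (2 * r + 1), k.val ≤ t →
        c (k - 1) = Real.sin ((k.val : ℝ) * θ) := by
      intro k hk
      by_cases h0 : k = 0
      · subst h0
        have hv : (0 - 1 : ZMod (2 * r + 1)).val = 2 * r := by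
          rw [zero_sub]
          exact ZMod.val_neg_one _
        simp only [c, hv]
        rw [if_neg (by omega)]
        simp
      · have hpos : 0 < k.val := Nat.pos_of_ne_zero fun h => h0 ((ZMod.val_eq_zero k).1 h)
        have h1 : (1 : ZMod (2 * r + 1)).val = 1 := by
          rw [ZMod.val_one_eq_one_mod, Nat.mod_eq_of_lt (by omega)]
        have hv : (k - 1).val = k.val - 1 := by
          rw [ZMod.val_sub (by omega), h1]
        simp only [c, hv]
        rw [if_pos (by omega)]
        push_cast [Nat.cast_sub (show 1 ≤ k.val from hpos)]
        ring_nf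
    -- Neighbouring sines add up to 2 cos θ times the middle one, so 4λ = 2 + 2 cos θ.
    refine ⟨(1 + Real.cos θ) / 2, ⟨bobbyCertificate r t _ c (fun k => ?_) (fun k => ?_)
      fun k hk => ?_⟩⟩
    · simp only [c]
      split_ifs with h
      · exact (hsin _ h).le
      · exact le_rfl
    · simp only [c]
      split_ifs with h
      · exact iff_of_true (hsin _ h).ne' h
      · simp [h]
    · rw [hadd k hk, hsub k hk]
      simp only [c, if_pos hk]
      have h1 : ((k.val : ℝ) + 2) * θ = ((k.val : ℝ) + 1) * θ + θ := by ring
      have h2 : (k.val : ℝ) * θ = ((k.val : ℝ) + 1) * θ - θ := by ring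
      rw [h1, h2, Real.sin_add, Real.sin_sub]
      ring

end PhaseGame

theorem mainTheorem3 (r s t : ℕ) (hr : 0 < r) (hs : 0 < s) :
    ∃ α : ℝ,
      IsGreatest (Set.range fun E : PhaseGame.Evelyn (Fin 2) t =>
        PhaseGame.passProb (PhaseGame.bobby r) E) α ∧
      IsGreatest (Set.range fun E : PhaseGame.Evelyn (Fin s → Fin 2) t =>
        PhaseGame.passProb ((PhaseGame.bobby r).parallel s) E) (α ^ s) := by
  obtain ⟨lam, ⟨C⟩⟩ := PhaseGame.exists_bobbyCertificate r t
  exact ⟨lam, C.isGreatest, (C.parallel s).isGreatest⟩
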